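/- Let $(\Omega,\mathcal F,\mathbb P)$ be a probability space, let $\mathbb X=(X_n,\,n\ge 1)$ be a strictly stationary sequence of real random variables on it, and let $a>0$. Let $\mathcal I^{\mathbb X}$ be the sigma-field of all $A\subseteq\Omega$ for which there is a Borel set $B\subseteq\mathbb R^{\mathbb N}$ with $A=\{\omega:(X_i(\omega),X_{i+1}(\omega),\dots)\in B\}$ for every $i\ge 1$. The conditional right endpoint $\gamma_1(X_1\mid\mathcal I^{\mathbb X})$ of the support of $X_1$ is an $\mathcal I^{\mathbb X}$-measurable function $Q:\Omega\to[-\infty,\infty]$ such that $\mathbb P(X_1\le Q\mid\mathcal I^{\mathbb X})=1$ a.s. and such that $Q\le Q_1$ a.s. for every $\mathcal I^{\mathbb X}$-measurable $Q_1:\Omega\to[-\infty,\infty]$ with $\mathbb P(X_1\le Q_1\mid\mathcal I^{\mathbb X})=1$ a.s. (it is unique up to a.s. equality). Suppose that $\gamma_1(X_1\mid\mathcal I^{\mathbb X})=\infty$ a.s. Let $(k_n,\,n\ge 1)$ be integers with $1\le k_n\le n$ for all $n\ge1$ and $k_n/n\to 1$ as $n\to\infty$. Let $(N(t),\,t\ge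 0)$ be a family of random variables on $(\Omega,\mathcal F,\mathbb P)$ with values in $\{0,1,2,\dots\}$, let $Z$ be an a.s. positive real random variable, and let $c:[0,\infty)\to(0,\infty)$ satisfy $c(t)\to\infty$ as $t\to\infty$. With $X_{1:n}\le\dots\le X_{n:n}$ denoting the order statistics of $X_1,\dots,X_n$, put $$\mathcal K_t(k_{N(t)},a)=\sum_{i=1}^{N(t)} I\big(X_{k_{N(t)}:N(t)}-a<X_i<X_{k_{N(t)}:N(t)}\big),$$ where the empty sum is $0$. No independence between $(N(t))$ and $\mathbb X$ is assumed. (i) If $Z$ is defined on $(\Omega,\mathcal F,\mathbb P)$ and $N(t)/c(t)\to Z$ a.s. as $t\to\infty$, then $\mathcal K_t(k_{N(t)},a)/c(t)\to 0$ a.s. as $t\to\infty$. (ii) If $N(t)/c(t)\to Z$ in distribution as $t\to\infty$ (where $Z$ may be defined on any probability space), then $\mathcal K_t(k_{N(t)},a)/c(t)\to 0$ in probability as $t\to\infty$. -/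

import Mathlib

open MeasureTheory ProbabilityTheory Filter Topology
open scoped NNReal

namespace NearMax

noncomputable section

/-! Random sequences `X₁, X₂, …` are indexed from zero: `X i` stands for `X_{i+1}`. -/

/-- `X₁, X₂, …` is strictly stationary under `P`: every shifted sequence `(X_{1+k}, X_{2+k}, …)` has
the same law on the sequence space (with its product sigma-field) as `(X₁, X₂, …)`. -/
def StrictlyStationary {Ω : Type*} [MeasurableSpace Ω] (P : Measure Ω) (X : ℕ → Ω → ℝ) : Prop :=
  ∀ k : ℕ, P.map (fun ω n => X (n + k) ω) = P.map (fun ω n => X n ω)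

/-- The sigma-field of the sets `A` that are invariant with respect to the sequence `X`: there is a
Borel set `B` of real sequences such that `A = {ω | (X_i ω, X_{i+1} ω, …) ∈ B}` for every `i`. -/
def invariantSigma {Ω : Type*} (X : ℕ → Ω → ℝ) : MeasurableSpace Ω where
  MeasurableSet' A := ∃ B : Set (ℕ → ℝ), MeasurableSet B ∧
    ∀ i : ℕ, A = {ω | (fun n => X (n + i) ω) ∈ B}
  measurableSet_empty := ⟨∅, MeasurableSet.empty, fun _ => rfl⟩
  measurableSet_compl := by
    rintro A ⟨B, hB, hA⟩
    exact ⟨Bᶜ, hB.compl, fun i => by rw [hA i]; rfl⟩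
  measurableSet_iUnion := by
    intro f hf
    choose B hB hA using hf
    refine ⟨⋃ j, B j, MeasurableSet.iUnion hB, fun i => ?_⟩
    ext ω
    simp only [Set.mem_iUnion, Set.mem_ofPred_eq]
    exact exists_congr fun j => by rw [hA j i]; rfl

/-- The invariant sigma-field of a sequence of random variables is a sub-sigma-field. -/
theorem invariantSigma_le {Ω : Type*} [m₀ : MeasurableSpace Ω] {X : ℕ → Ω → ℝ}
    (hX : ∀ n, Measurable (X n)) : invariantSigma X ≤ m₀ := by
  rintro A ⟨B, hB, hA⟩
  rw [hA 0]
  exact measurable_pi_lambda (fun ω n => X (n + 0) ω) (fun n => hX (n + 0)) hB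

/-- `Q` is (a version of) the conditional right endpoint `γ₁(X | 𝒢)` of the support of the random
variable `X` given the sigma-field `𝒢`. -/
structure IsCondRightEndpoint {Ω : Type*} [MeasurableSpace Ω] (P : Measure Ω) (X : Ω → ℝ)
    (𝒢 : MeasurableSpace Ω) (Q : Ω → EReal) : Prop where
  measurable : Measurable[𝒢] Q
  le_endpoint : P⟦{ω | (X ω : EReal) ≤ Q ω} | 𝒢⟧ =ᵐ[P] fun _ => (1 : ℝ)
  minimal : ∀ Q₁ : Ω → EReal, Measurable[𝒢] Q₁ →
    (P⟦{ω | (X ω : EReal) ≤ Q₁ ω} | 𝒢⟧ =ᵐ[P] fun _ => (1 : ℝ)) → ∀ᵐ ω ∂P, Q ω ≤ Q₁ ω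

/-- The `k`-th order statistic `x_{k:n}` of the sample `x₁, …, x_n` (that is, of `x 0, …, x (n - 1)`),
`1 ≤ k ≤ n`: the `k`-th entry of the sample sorted in nondecreasing order. It is never used outside
that range, where it is set to `0`. -/
def orderStat (x : ℕ → ℝ) (n k : ℕ) : ℝ :=
  if h : 1 ≤ k ∧ k ≤ n then
    (fun i : Fin n => x i) (Tuple.sort (fun i : Fin n => x i) ⟨k - 1, by omega⟩)
  else 0

/-- `K(k, n, a)`: the number of `i ≤ n` with `x_{k:n} - a < x_i < x_{k:n}`. For `n = 0` the sum is
empty and equals `0`. -/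
def nearCount (x : ℕ → ℝ) (k n : ℕ) (a : ℝ) : ℝ :=
  ∑ i ∈ Finset.range n,
    (Set.Ioo (orderStat x n k - a) (orderStat x n k)).indicator (fun _ => (1 : ℝ)) (x i)

/-- `𝒦_t(k_{N(t)}, a)`: the number of claims registered in `[0, t]` that lie in the open left
`a`-neighbourhood of the `k_{N(t)}`-th order statistic of the first `N(t)` claims. -/
def nearClaimCount {Ω : Type*} (X : ℕ → Ω → ℝ) (N : ℝ≥0 → Ω → ℕ) (k : ℕ → ℕ) (a : ℝ)
    (t : ℝ≥0) (ω : Ω) : ℝ :=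
  nearCount (fun i => X i ω) (k (N t ω)) (N t ω) a

end

end NearMax

/-! The strong law `K_n = o(n)` for `K_n = K(k_n, n, a)` rests on two consequences of the maximal
ergodic theorem for a measure-preserving map `T`. Sets of small measure are visited with uniformly
small frequency, so for a high level `y` only a small fraction of the sample exceeds `y`. And almost
every point of a set `A` visits `A` with positive lower frequency; since the set of points with this
property is invariant, an infinite conditional endpoint forces a positive fraction of the sample
above every level. As `k_n / n → 1`, the order statistic `X_{k_n:n}` then eventually exceeds
`y + a`, and `K_n` counts only observations above `y`.

For a random index, `K_n = o(n)` is used in the form `|K_n| ≤ ε n + C_ε` for all `n`, with a random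
variable `C_ε` that does not depend on `n`. Hence `|K_N| / c ≤ ε N / c + C_ε / c` whatever the joint
law of `N` and `X`, where `N / c` is bounded, respectively tight, and `C_ε / c → 0`. -/

namespace NearMax

section MaximalErgodic

variable {α : Type*} {T : α → α} {g : α → ℝ}

/-- The running maximum of the Birkhoff sums of `g` along `T` of lengths `0, …, n`. The empty sum is
included, so it is nonnegative. -/
noncomputable def birkhoffMax (T : α → α) (g : α → ℝ) : ℕ →o (α → ℝ) :=
  partialSups (birkhoffSum T g)

theorem birkhoffMax_apply (n : ℕ) (x : α) :
    birkhoffMax T g n x = partialSups (fun k => birkhoffSum T g k x) n :=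
  Pi.partialSups_apply _ _ _

theorem birkhoffMax_nonneg (n : ℕ) (x : α) : 0 ≤ birkhoffMax T g n x := by
  rw [birkhoffMax_apply]
  exact le_partialSups_of_le (fun k => birkhoffSum T g k x) (Nat.zero_le n)

theorem birkhoffMax_le_max (n : ℕ) (x : α) :
    birkhoffMax T g n x ≤ max 0 (g x + birkhoffMax T g n (T x)) := by
  simp only [birkhoffMax_apply]
  refine partialSups_le _ _ _ fun k hk => ?_
  cases k with
  | zero => exact le_max_left _ _
  | succ k =>
    rw [birkhoffSum_succ']
    have hmax := le_partialSups_of_le (fun i => birkhoffSum T g i (T x)) (k.le_succ.trans hk)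
    exact (add_le_add_right hmax _).trans (le_max_right _ _)

theorem setOf_exists_birkhoffSum_pos :
    {x | ∃ n, 0 < birkhoffSum T g n x} = ⋃ n, {x | 0 < birkhoffMax T g n x} := by
  ext x
  simp only [Set.mem_ofPred_eq, Set.mem_iUnion, birkhoffMax_apply]
  constructor
  · rintro ⟨n, hn⟩
    exact ⟨n, hn.trans_le (le_partialSups (fun k => birkhoffSum T g k x) n)⟩
  · rintro ⟨n, hn⟩
    obtain ⟨k, -, hk⟩ := exists_partialSups_eq (fun k => birkhoffSum T g k x) n
    exact ⟨k, hk ▸ hn⟩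

theorem birkhoffSum_indicator_of_mapsTo {B : Set α} (hB : Set.MapsTo T B B) (n : ℕ) {x : α}
    (hx : x ∈ B) : birkhoffSum T (B.indicator g) n x = birkhoffSum T g n x :=
  Finset.sum_congr rfl fun i _ => Set.indicator_of_mem (hB.iterate i hx) g

variable [MeasurableSpace α] {μ : Measure α}

theorem measurable_birkhoffSum {M : Type*} [AddCommMonoid M] [MeasurableSpace M]
    [MeasurableAdd₂ M] {f : α → M} (hT : Measurable T) (hf : Measurable f) (n : ℕ) :
    Measurable (birkhoffSum T f n) :=
  Finset.measurable_fun_sum _ fun i _ => hf.comp (hT.iterate i)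

theorem measurable_birkhoffMax (hT : Measurable T) (hg : Measurable g) (n : ℕ) :
    Measurable (birkhoffMax T g n) := by
  induction n with
  | zero => exact measurable_birkhoffSum hT hg 0
  | succ n ih =>
    rw [birkhoffMax, ← Order.succ_eq_add_one, partialSups_succ]
    exact ih.sup (measurable_birkhoffSum hT hg (n + 1))

theorem integrable_birkhoffSum (hT : MeasurePreserving T μ μ) (hg : Integrable g μ) (n : ℕ) :
    Integrable (birkhoffSum T g n) μ :=
  integrable_finsetSum _ fun i _ => (hT.iterate i).integrable_comp_of_integrable hg

theorem integrable_birkhoffMax (hT : MeasurePreserving T μ μ) (hg : Integrable g μ) (n : ℕ) :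
    Integrable (birkhoffMax T g n) μ := by
  induction n with
  | zero => exact integrable_birkhoffSum hT hg 0
  | succ n ih =>
    rw [birkhoffMax, ← Order.succ_eq_add_one, partialSups_succ]
    exact ih.sup (integrable_birkhoffSum hT hg (n + 1))

theorem setIntegral_birkhoffMax_pos_nonneg (hT : MeasurePreserving T μ μ) (hgm : Measurable g)
    (hg : Integrable g μ) (n : ℕ) : 0 ≤ ∫ x in {x | 0 < birkhoffMax T g n x}, g x ∂μ := by
  set M := birkhoffMax T g n
  have hM : Integrable M μ := integrable_birkhoffMax hT hg n
  have hMT : Integrable (fun x => M (T x)) μ := hT.integrable_comp_of_integrable hM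
  have hE : MeasurableSet {x | 0 < M x} :=
    measurableSet_lt measurable_const (measurable_birkhoffMax hT.measurable hgm n)
  have hle : ∀ x, M x - M (T x) ≤ {x | 0 < M x}.indicator g x := by
    intro x
    have hTx : 0 ≤ M (T x) := birkhoffMax_nonneg n (T x)
    by_cases hx : 0 < M x
    · rw [Set.indicator_of_mem (show x ∈ {x | 0 < M x} from hx)]
      rcases le_max_iff.1 (show M x ≤ max 0 (g x + M (T x)) from birkhoffMax_le_max n x)
        with h | h <;> linarith
    · rw [Set.indicator_of_notMem (show x ∉ {x | 0 < M x} from hx)]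
      linarith
  have hinv : ∫ x, M (T x) ∂μ = ∫ x, M x ∂μ := by
    conv_rhs => rw [← hT.map_eq]
    exact (integral_map hT.aemeasurable (hT.map_eq.symm ▸ hM.aestronglyMeasurable)).symm
  calc (0 : ℝ) = ∫ x, (M x - M (T x)) ∂μ := by rw [integral_sub hM hMT, hinv, sub_self]
    _ ≤ ∫ x, {x | 0 < M x}.indicator g x ∂μ := integral_mono (hM.sub hMT) (hg.indicator hE) hle
    _ = ∫ x in {x | 0 < M x}, g x ∂μ := integral_indicator hE

theorem setIntegral_exists_birkhoffSum_pos_nonneg (hT : MeasurePreserving T μ μ)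
    (hgm : Measurable g) (hg : Integrable g μ) :
    0 ≤ ∫ x in {x | ∃ n, 0 < birkhoffSum T g n x}, g x ∂μ := by
  rw [setOf_exists_birkhoffSum_pos]
  refine ge_of_tendsto' (tendsto_setIntegral_of_monotone (fun n => ?_) ?_ hg.integrableOn)
    fun n => setIntegral_birkhoffMax_pos_nonneg hT hgm hg n
  · exact measurableSet_lt measurable_const (measurable_birkhoffMax hT.measurable hgm n)
  · exact fun m n hmn x hx => lt_of_lt_of_le hx ((birkhoffMax T g).monotone hmn x)

theorem setIntegral_nonneg_of_exists_birkhoffSum_pos (hT : MeasurePreserving T μ μ)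
    (hgm : Measurable g) (hg : Integrable g μ) {B : Set α} (hBm : MeasurableSet B)
    (hB : Set.MapsTo T B B) (hpos : ∀ x ∈ B, ∃ n, 0 < birkhoffSum T g n x) :
    0 ≤ ∫ x in B, g x ∂μ := by
  have h := setIntegral_exists_birkhoffSum_pos_nonneg hT (hgm.indicator hBm) (hg.indicator hBm)
  have hsub : B ⊆ {x | ∃ n, 0 < birkhoffSum T (B.indicator g) n x} := fun x hx =>
    (hpos x hx).imp fun n hn => by rwa [birkhoffSum_indicator_of_mapsTo hB n hx]
  rwa [setIntegral_indicator hBm, Set.inter_eq_self_of_subset_right hsub] at h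

end MaximalErgodic

section VisitFrequency

variable {α : Type*} {T : α → α} {A : Set α}

/-- The number of visits to `A` among the first `n` points `x, T x, …, T^{n-1} x` of the orbit
of `x`. -/
noncomputable def visitCount (T : α → α) (A : Set α) (n : ℕ) (x : α) : ℕ :=
  birkhoffSum T (A.indicator 1) n x

/-- The points that visit `A` with positive lower frequency: at least `n / j` of the first `n`
points of the orbit lie in `A`, for some `j` and all large `n`. -/
def positiveFrequency (T : α → α) (A : Set α) : Set α :=
  {x | ∃ j : ℕ, ∀ᶠ n in atTop, n ≤ j * visitCount T A n x}

theorem visitCount_succ' (n : ℕ) (x : α) :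
    visitCount T A (n + 1) x = A.indicator 1 x + visitCount T A n (T x) :=
  birkhoffSum_succ' _ _ _ _

theorem visitCount_le_succ (n : ℕ) (x : α) : visitCount T A n x ≤ visitCount T A (n + 1) x := by
  rw [visitCount, visitCount, birkhoffSum_succ]
  exact Nat.le_add_right _ _

theorem birkhoffSum_const_add_mul_indicator (c d : ℝ) (n : ℕ) (x : α) :
    birkhoffSum T (fun x => c + d * A.indicator 1 x) n x = n * c + d * visitCount T A n x := by
  have hcast (y : α) : ((A.indicator 1 y : ℕ) : ℝ) = A.indicator 1 y := by
    by_cases hy : y ∈ A <;> simp [hy]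
  simp [birkhoffSum, visitCount, Finset.sum_add_distrib, Finset.mul_sum, hcast]

theorem preimage_positiveFrequency : T ⁻¹' positiveFrequency T A = positiveFrequency T A := by
  ext x
  constructor
  · rintro ⟨j, hj⟩
    obtain ⟨p, hp⟩ := eventually_atTop.1 hj
    refine ⟨j + 1, eventually_atTop.2 ⟨p + 2, fun n hn => ?_⟩⟩
    obtain ⟨n, rfl⟩ := Nat.exists_eq_add_of_le' (by lia : 1 ≤ n)
    have hTx := hp n (by lia)
    have hle : visitCount T A n (T x) ≤ visitCount T A (n + 1) x := by
      rw [visitCount_succ']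
      exact Nat.le_add_left _ _
    have hpos : 0 < visitCount T A n (T x) := Nat.pos_of_ne_zero fun h => by simp [h] at hTx; lia
    nlinarith
  · rintro ⟨j, hj⟩
    refine ⟨2 * j, ?_⟩
    filter_upwards [hj, eventually_ge_atTop (2 * j)] with n hn hjn
    have hle : visitCount T A n x ≤ 1 + visitCount T A n (T x) := by
      refine (visitCount_le_succ n x).trans ?_
      rw [visitCount_succ']
      gcongr
      exact Set.indicator_le_self' (fun _ _ => zero_le_one) x
    nlinarith

variable [MeasurableSpace α]

theorem measurable_const_add_mul_indicator (hA : MeasurableSet A) (c d : ℝ) :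
    Measurable fun x => c + d * A.indicator 1 x :=
  measurable_const.add ((measurable_one.indicator hA).const_mul d)

theorem measurable_visitCount (hT : Measurable T) (hA : MeasurableSet A) (n : ℕ) :
    Measurable (visitCount T A n) :=
  measurable_birkhoffSum hT (measurable_one.indicator hA) n

theorem measurableSet_positiveFrequency (hT : Measurable T) (hA : MeasurableSet A) :
    MeasurableSet (positiveFrequency T A) := by
  simp only [positiveFrequency, eventually_atTop, Set.ofPred_exists, Set.ofPred_forall]
  exact .iUnion fun j => .iUnion fun p => .iInter fun n => .iInter fun _ =>
    measurableSet_le measurable_const ((measurable_visitCount hT hA n).const_mul j)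

variable {μ : Measure α} [IsFiniteMeasure μ]

theorem integrable_const_add_mul_indicator (hA : MeasurableSet A) (c d : ℝ) :
    Integrable (fun x => c + d * A.indicator 1 x) μ :=
  (integrable_const c).add (((integrable_const (1 : ℝ)).indicator hA).const_mul d)

theorem setIntegral_const_add_mul_indicator (hA : MeasurableSet A) (c d : ℝ) (E : Set α) :
    ∫ x in E, (c + d * A.indicator 1 x) ∂μ = c * μ.real E + d * μ.real (E ∩ A) := by
  have hind : Integrable (fun x => d * A.indicator (1 : α → ℝ) x) (μ.restrict E) :=
    ((integrable_const (1 : ℝ)).indicator hA).const_mul d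
  rw [integral_add (integrable_const c) hind, integral_const_mul, integral_indicator_one hA,
    measureReal_restrict_apply hA, Set.inter_comm A]
  simp [mul_comm]

theorem measureReal_exists_lt_mul_visitCount_le (hT : MeasurePreserving T μ μ)
    (hA : MeasurableSet A) (j : ℕ) :
    μ.real {x | ∃ n, n < j * visitCount T A n x} ≤ j * μ.real A := by
  set E := {x | ∃ n, n < j * visitCount T A n x}
  have hE : {x | ∃ n, 0 < birkhoffSum T (fun x => -1 + (j : ℝ) * A.indicator 1 x) n x} = E := by
    simp only [birkhoffSum_const_add_mul_indicator, mul_neg_one, lt_neg_add_iff_lt, E]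
    norm_cast
  have h := setIntegral_exists_birkhoffSum_pos_nonneg hT
    (measurable_const_add_mul_indicator hA (-1) j)
    (integrable_const_add_mul_indicator hA (-1) j)
  rw [hE, setIntegral_const_add_mul_indicator hA] at h
  have hEA : (j : ℝ) * μ.real (E ∩ A) ≤ j * μ.real A :=
    mul_le_mul_of_nonneg_left (measureReal_mono Set.inter_subset_right) j.cast_nonneg
  linarith

theorem mul_measureReal_inter_le_of_exists_mul_visitCount_lt (hT : MeasurePreserving T μ μ)
    (hA : MeasurableSet A) {B : Set α} (hB : MeasurableSet B) (hTB : Set.MapsTo T B B) {j : ℕ}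
    (hlt : ∀ x ∈ B, ∃ n, j * visitCount T A n x < n) :
    j * μ.real (B ∩ A) ≤ μ.real B := by
  have h := setIntegral_nonneg_of_exists_birkhoffSum_pos hT
    (measurable_const_add_mul_indicator hA 1 (-j))
    (integrable_const_add_mul_indicator hA 1 (-j)) hB hTB fun x hx => (hlt x hx).imp fun n hn => by
      have hn' : (j : ℝ) * visitCount T A n x < n := by exact_mod_cast hn
      rw [birkhoffSum_const_add_mul_indicator]
      linarith
  rw [setIntegral_const_add_mul_indicator hA] at h
  linarith

theorem ae_exists_forall_mul_visitCount_le (hT : MeasurePreserving T μ μ) {A : ℕ → Set α}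
    (hA : ∀ m, MeasurableSet (A m)) (hlim : Tendsto (fun m => μ.real (A m)) atTop (𝓝 0)) :
    ∀ᵐ x ∂μ, ∀ j : ℕ, ∃ m, ∀ n, j * visitCount T (A m) n x ≤ n := by
  refine ae_all_iff.2 fun j => ?_
  have hzero : μ.real {x | ∀ m, ∃ n, n < j * visitCount T (A m) n x} = 0 := by
    refine le_antisymm (ge_of_tendsto' (by simpa using hlim.const_mul (j : ℝ)) fun m => ?_)
      measureReal_nonneg
    exact (measureReal_mono (Set.ofPred_subset_ofPred.2 fun x hx => hx m)).trans
      (measureReal_exists_lt_mul_visitCount_le hT (hA m) j)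
  rw [ae_iff]
  push Not
  exact (measureReal_eq_zero_iff).1 hzero

theorem ae_mem_positiveFrequency (hT : MeasurePreserving T μ μ) (hA : MeasurableSet A) :
    ∀ᵐ x ∂μ, x ∈ A → x ∈ positiveFrequency T A := by
  set B := (positiveFrequency T A)ᶜ
  have hB : MeasurableSet B := (measurableSet_positiveFrequency hT.measurable hA).compl
  have hTB : Set.MapsTo T B B := by
    rw [Set.mapsTo_iff_subset_preimage, Set.preimage_compl, preimage_positiveFrequency]
  have hbound (j : ℕ) : j * μ.real (B ∩ A) ≤ μ.real B := by
    refine mul_measureReal_inter_le_of_exists_mul_visitCount_lt hT hA hB hTB fun x hx => ?_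
    by_contra! hle
    exact hx ⟨j, .of_forall hle⟩
  have hzero : μ.real (B ∩ A) = 0 := by
    by_contra hne
    obtain ⟨j, hj⟩ := exists_nat_gt (μ.real B / μ.real (B ∩ A))
    rw [div_lt_iff₀ (measureReal_nonneg.lt_of_ne' hne)] at hj
    exact (hbound j).not_gt hj
  rw [ae_iff]
  convert! (measureReal_eq_zero_iff).1 hzero using 2
  ext x
  simp [B, and_comm]

end VisitFrequency

section OrderStatistics

/-- The number of entries among `x₀, …, x_{n-1}` that exceed `y`. -/
noncomputable def exceedCount (x : ℕ → ℝ) (y : ℝ) (n : ℕ) : ℕ :=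
  {i ∈ Finset.range n | y < x i}.card

theorem lt_orderStat_iff {x : ℕ → ℝ} {y : ℝ} {n k : ℕ} (hk : 1 ≤ k ∧ k ≤ n) :
    y < orderStat x n k ↔ n < k + exceedCount x y n := by
  set s : Fin n → ℝ := fun i => x i
  have hcard : Finset.card {i | (s ∘ Tuple.sort s) i ≤ y} =
      {i ∈ Finset.range n | x i ≤ y}.card := by
    simp only [Finset.card_filter, Finset.sum_range]
    exact Equiv.sum_comp (Tuple.sort s) fun i => if s i ≤ y then 1 else 0
  have hsum : {i ∈ Finset.range n | x i ≤ y}.card + exceedCount x y n = n := by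
    simpa [exceedCount] using
      Finset.card_filter_add_card_filter_not (s := Finset.range n) fun i => x i ≤ y
  have hle : orderStat x n k ≤ y ↔ k - 1 < {i ∈ Finset.range n | x i ≤ y}.card := by
    rw [orderStat, dif_pos hk, ← hcard]
    exact (Tuple.lt_card_le_iff_apply_le_of_monotone (Tuple.monotone_sort s)).symm
  rw [← not_le, hle]
  lia

theorem nearCount_nonneg (x : ℕ → ℝ) (k n : ℕ) (a : ℝ) : 0 ≤ nearCount x k n a :=
  Finset.sum_nonneg fun _ _ => Set.indicator_nonneg (fun _ _ => zero_le_one) _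

theorem nearCount_le_exceedCount {x : ℕ → ℝ} {k n : ℕ} {a y : ℝ}
    (h : y + a ≤ orderStat x n k) : nearCount x k n a ≤ exceedCount x y n := by
  rw [exceedCount, Finset.card_filter, Nat.cast_sum]
  refine Finset.sum_le_sum fun i _ => ?_
  refine Set.indicator_apply_le' (fun hi => ?_) fun _ => Nat.cast_nonneg _
  rw [if_pos (by linarith [hi.1]), Nat.cast_one]

theorem eventually_lt_orderStat {x : ℕ → ℝ} {k : ℕ → ℕ} {y : ℝ} {j : ℕ}
    (hk : ∀ᶠ n in atTop, k n ≤ n)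
    (hklim : Tendsto (fun n : ℕ => (k n : ℝ) / (n : ℝ)) atTop (𝓝 1))
    (hj : ∀ᶠ n in atTop, n ≤ j * exceedCount x y n) :
    ∀ᶠ n in atTop, y < orderStat x n (k n) := by
  have hrank : ∀ᶠ n : ℕ in atTop, 1 - 1 / ((j : ℝ) + 1) < k n / n :=
    hklim.eventually_const_lt (sub_lt_self 1 Nat.one_div_pos_of_nat)
  filter_upwards [hk, hrank, hj, eventually_gt_atTop 0] with n hkn hrank hj hn
  have hexceed : n < k n + exceedCount x y n := by
    rw [lt_div_iff₀ (Nat.cast_pos.2 hn)] at hrank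
    field_simp at hrank
    have hrank' : j * n < k n * (j + 1) := by
      have : (j : ℝ) * n < k n * (j + 1) := by linarith
      exact_mod_cast this
    nlinarith
  have hle : exceedCount x y n ≤ n := (Finset.card_filter_le _ _).trans_eq (Finset.card_range n)
  exact (lt_orderStat_iff ⟨by lia, hkn⟩).2 hexceed

theorem isLittleO_nearCount {x : ℕ → ℝ} {k : ℕ → ℕ} (hk : ∀ᶠ n in atTop, k n ≤ n)
    (hklim : Tendsto (fun n : ℕ => (k n : ℝ) / (n : ℝ)) atTop (𝓝 1)) (a : ℝ)
    (hmany : ∀ m : ℕ, ∃ j, ∀ᶠ n in atTop, n ≤ j * exceedCount x m n)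
    (hfew : ∀ j, ∃ m : ℕ, ∀ᶠ n in atTop, j * exceedCount x m n ≤ n) :
    (fun n => nearCount x (k n) n a) =o[atTop] fun n => (n : ℝ) := by
  refine Asymptotics.isLittleO_iff_nat_mul_le.2 fun j => ?_
  obtain ⟨m, hm⟩ := hfew j
  obtain ⟨p, hp⟩ := exists_nat_ge (m + a)
  obtain ⟨i, hi⟩ := hmany p
  filter_upwards [hm, eventually_lt_orderStat hk hklim hi] with n hn hord
  rw [Real.norm_of_nonneg (nearCount_nonneg x (k n) n a), Real.norm_of_nonneg n.cast_nonneg]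
  calc j * nearCount x (k n) n a ≤ j * exceedCount x m n :=
        mul_le_mul_of_nonneg_left (nearCount_le_exceedCount (hp.trans hord.le)) j.cast_nonneg
    _ ≤ n := by exact_mod_cast hn

end OrderStatistics

section Shift

/-- The left shift on sequences. -/
def shift {β : Type*} (x : ℕ → β) : ℕ → β := fun n => x (n + 1)

theorem shift_iterate_apply {β : Type*} (i n : ℕ) (x : ℕ → β) : shift^[i] x n = x (n + i) := by
  induction i generalizing x with
  | zero => rfl
  | succ i ih => rw [Function.iterate_succ_apply, ih, shift, add_assoc]

theorem measurable_shift {β : Type*} [MeasurableSpace β] :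
    Measurable (shift : (ℕ → β) → ℕ → β) :=
  measurable_pi_lambda _ fun n => measurable_pi_apply (n + 1)

theorem visitCount_shift (y : ℝ) (n : ℕ) (x : ℕ → ℝ) :
    visitCount shift {x | y < x 0} n x = exceedCount x y n := by
  simp [visitCount, birkhoffSum, exceedCount, Set.indicator_apply, shift_iterate_apply]

theorem measurableSet_lt_apply_zero (y : ℝ) : MeasurableSet {x : ℕ → ℝ | y < x 0} :=
  measurableSet_lt measurable_const (measurable_pi_apply 0)

theorem measurable_exceedCount (y : ℝ) (n : ℕ) : Measurable fun x => exceedCount x y n := by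
  simp only [← visitCount_shift]
  exact measurable_visitCount measurable_shift (measurableSet_lt_apply_zero y) n

theorem measurable_orderStat (n k : ℕ) : Measurable fun x => orderStat x n k := by
  by_cases hk : 1 ≤ k ∧ k ≤ n
  · refine measurable_of_Ioi fun y => ?_
    simp only [Set.preimage, Set.mem_Ioi, lt_orderStat_iff hk]
    exact measurableSet_lt measurable_const ((measurable_exceedCount y n).const_add k)
  · simp only [orderStat, dif_neg hk]
    exact measurable_const

theorem measurable_nearCount (k n : ℕ) (a : ℝ) : Measurable fun x => nearCount x k n a := by
  refine Finset.measurable_fun_sum _ fun i _ => ?_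
  have hs : MeasurableSet {x : ℕ → ℝ | orderStat x n k - a < x i ∧ x i < orderStat x n k} :=
    (measurableSet_lt ((measurable_orderStat n k).sub_const a) (measurable_pi_apply i)).inter
      (measurableSet_lt (measurable_pi_apply i) (measurable_orderStat n k))
  exact (measurable_const (a := (1 : ℝ))).indicator hs

theorem measurableSet_invariantSigma_of_preimage_shift_eq {Ω : Type*} {X : ℕ → Ω → ℝ}
    {B : Set (ℕ → ℝ)} (hB : MeasurableSet B) (hinv : shift ⁻¹' B = B) :
    MeasurableSet[invariantSigma X] {ω | (fun n => X n ω) ∈ B} := by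
  refine ⟨B, hB, fun i => Set.ext fun ω => ?_⟩
  have hshift : (fun n => X (n + i) ω) = shift^[i] fun n => X n ω :=
    funext fun n => (shift_iterate_apply i n fun n => X n ω).symm
  have hiter : shift^[i] ⁻¹' B = B := by
    rw [Set.preimage_iterate_eq, Function.iterate_fixed hinv]
  rw [Set.mem_ofPred_eq, Set.mem_ofPred_eq, hshift, ← Set.mem_preimage, hiter]

variable {μ : Measure (ℕ → ℝ)} [IsFiniteMeasure μ]

theorem ae_exists_forall_mul_exceedCount_le (hT : MeasurePreserving shift μ μ) :
    ∀ᵐ x ∂μ, ∀ j : ℕ, ∃ m : ℕ, ∀ n, j * exceedCount x m n ≤ n := by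
  have hlim : Tendsto (fun m : ℕ => μ.real {x | (m : ℝ) < x 0}) atTop (𝓝 0) := by
    have hanti : Antitone fun m : ℕ => {x : ℕ → ℝ | (m : ℝ) < x 0} := fun m p hmp x hx =>
      lt_of_le_of_lt (Nat.cast_le.2 hmp) (show (p : ℝ) < x 0 from hx)
    have hempty : ⋂ m : ℕ, {x : ℕ → ℝ | (m : ℝ) < x 0} = ∅ := by
      ext x
      simpa using exists_nat_ge (x 0)
    have h := tendsto_measure_iInter_atTop (μ := μ)
      (fun m : ℕ => (measurableSet_lt_apply_zero m).nullMeasurableSet) hanti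
      ⟨0, measure_ne_top _ _⟩
    rw [hempty, measure_empty] at h
    exact (ENNReal.tendsto_toReal ENNReal.zero_ne_top).comp h
  simpa only [visitCount_shift] using
    ae_exists_forall_mul_visitCount_le hT (fun m : ℕ => measurableSet_lt_apply_zero m) hlim

end Shift

section CondRightEndpoint

variable {Ω : Type*} {𝒢 : MeasurableSpace Ω} [m₀ : MeasurableSpace Ω] {P : Measure Ω}
  [IsFiniteMeasure P] {Y : Ω → ℝ} {Q : Ω → EReal}

theorem IsCondRightEndpoint.ae_le (hQ : IsCondRightEndpoint P Y 𝒢 Q) (h𝒢 : 𝒢 ≤ m₀)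
    {Q₁ : Ω → EReal} (hQ₁ : Measurable[𝒢] Q₁) (hle : ∀ᵐ ω ∂P, (Y ω : EReal) ≤ Q₁ ω) :
    ∀ᵐ ω ∂P, Q ω ≤ Q₁ ω := by
  have hone : ({ω | (Y ω : EReal) ≤ Q₁ ω}.indicator fun _ => (1 : ℝ)) =ᵐ[P] fun _ => (1 : ℝ) := by
    filter_upwards [hle] with ω hω
    exact Set.indicator_of_mem (show ω ∈ {ω | (Y ω : EReal) ≤ Q₁ ω} from hω) _
  exact hQ.minimal Q₁ hQ₁ ((condExp_congr_ae hone).trans (condExp_const h𝒢 1).eventuallyEq)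

theorem IsCondRightEndpoint.ae_mem_of_ae_le_off (hQ : IsCondRightEndpoint P Y 𝒢 Q)
    (h𝒢 : 𝒢 ≤ m₀) (htop : ∀ᵐ ω ∂P, Q ω = ⊤) {A : Set Ω}
    (hA : MeasurableSet[𝒢] A) {y : ℝ} (hle : ∀ᵐ ω ∂P, ω ∉ A → Y ω ≤ y) : ∀ᵐ ω ∂P, ω ∈ A := by
  classical
  have hmeas : Measurable[𝒢] (A.piecewise (fun _ => ⊤) fun _ => (y : EReal)) :=
    Measurable.piecewise hA (@measurable_const _ _ _ 𝒢 _) (@measurable_const _ _ _ 𝒢 _)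
  have hbound : ∀ᵐ ω ∂P, (Y ω : EReal) ≤ A.piecewise (fun _ => ⊤) (fun _ => (y : EReal)) ω := by
    filter_upwards [hle] with ω hω
    by_cases hωA : ω ∈ A
    · simp [hωA]
    · simpa [hωA] using hω hωA
  filter_upwards [hQ.ae_le h𝒢 hmeas hbound, htop] with ω hω htop
  by_contra hωA
  simp [hωA, htop] at hω

end CondRightEndpoint

section Stationary

variable {Ω : Type*} [MeasurableSpace Ω] {P : Measure Ω} {X : ℕ → Ω → ℝ}

theorem StrictlyStationary.measurePreserving_shift (hX : ∀ n, Measurable (X n))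
    (hstat : StrictlyStationary P X) :
    MeasurePreserving shift (P.map fun ω n => X n ω) (P.map fun ω n => X n ω) := by
  refine ⟨measurable_shift, ?_⟩
  rw [Measure.map_map measurable_shift (measurable_pi_lambda _ hX)]
  exact hstat 1

theorem ae_mem_positiveFrequency_of_condRightEndpoint_eq_top [IsFiniteMeasure P]
    (hX : ∀ n, Measurable (X n)) (hstat : StrictlyStationary P X) {γ : Ω → EReal}
    (hγ : IsCondRightEndpoint P (X 0) (invariantSigma X) γ) (hγtop : ∀ᵐ ω ∂P, γ ω = ⊤) (y : ℝ) :
    ∀ᵐ ω ∂P, (fun n => X n ω) ∈ positiveFrequency shift {x : ℕ → ℝ | y < x 0} := by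
  have hB := measurableSet_lt_apply_zero y
  have hrec := ae_of_ae_map (measurable_pi_lambda _ hX).aemeasurable
    (ae_mem_positiveFrequency (hstat.measurePreserving_shift hX) hB)
  refine hγ.ae_mem_of_ae_le_off (y := y) (invariantSigma_le hX) hγtop
    (measurableSet_invariantSigma_of_preimage_shift_eq
      (measurableSet_positiveFrequency measurable_shift hB) preimage_positiveFrequency) ?_
  filter_upwards [hrec] with ω hω hnot
  exact not_lt.1 fun hlt => hnot (hω hlt)

theorem ae_isLittleO_nearCount [IsFiniteMeasure P] (hX : ∀ n, Measurable (X n))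
    (hstat : StrictlyStationary P X) {γ : Ω → EReal}
    (hγ : IsCondRightEndpoint P (X 0) (invariantSigma X) γ) (hγtop : ∀ᵐ ω ∂P, γ ω = ⊤)
    {k : ℕ → ℕ} (hk : ∀ᶠ n in atTop, k n ≤ n)
    (hklim : Tendsto (fun n : ℕ => (k n : ℝ) / (n : ℝ)) atTop (𝓝 1)) (a : ℝ) :
    ∀ᵐ ω ∂P, (fun n => nearCount (fun i => X i ω) (k n) n a) =o[atTop] fun n => (n : ℝ) := by
  have hfew := ae_of_ae_map (measurable_pi_lambda _ hX).aemeasurable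
    (ae_exists_forall_mul_exceedCount_le (hstat.measurePreserving_shift hX))
  have hmany := ae_all_iff.2 fun m : ℕ =>
    ae_mem_positiveFrequency_of_condRightEndpoint_eq_top hX hstat hγ hγtop m
  simp only [positiveFrequency, Set.mem_ofPred_eq, visitCount_shift] at hmany
  filter_upwards [hfew, hmany] with ω hfew hmany
  exact isLittleO_nearCount hk hklim a hmany fun j =>
    (hfew j).imp fun _ hm => .of_forall hm

end Stationary

section RandomIndex

/-- The least `C` with `|u n| ≤ ε * n + C` for all `n`. It is meaningful for `u = o(n)` and `0 < ε`,
when the supremum is finite. -/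
noncomputable def linearExcess (ε : ℝ) (u : ℕ → ℝ) : ℝ := ⨆ n, (|u n| - ε * n)

theorem measurable_linearExcess (ε : ℝ) : Measurable (linearExcess ε) :=
  .iSup fun n => (measurable_pi_apply n).abs.sub_const _

theorem abs_le_add_linearExcess {u : ℕ → ℝ} (hu : u =o[atTop] fun n => (n : ℝ)) {ε : ℝ}
    (hε : 0 < ε) (n : ℕ) : |u n| ≤ ε * n + linearExcess ε u := by
  have hev : ∀ᶠ n : ℕ in atTop, |u n| - ε * n ≤ 0 := by
    filter_upwards [hu.def hε] with n hn
    rw [Real.norm_eq_abs, Real.norm_natCast] at hn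
    exact sub_nonpos.2 hn
  have hle : |u n| - ε * n ≤ linearExcess ε u :=
    le_ciSup (isBoundedUnder_of_eventually_le hev).bddAbove_range n
  linarith

theorem abs_div_lt_of_linearExcess_lt {u : ℕ → ℝ} (hu : u =o[atTop] fun n => (n : ℝ))
    {δ L c : ℝ} (hδ : 0 < δ) (hL : 0 < L) (hc : 0 < c) {n : ℕ} (hn : n / c < L)
    (hexc : linearExcess (δ / (2 * L)) u < δ / 2 * c) : |u n| / c < δ := by
  have hε : 0 < δ / (2 * L) := by positivity
  rw [div_lt_iff₀ hc] at hn ⊢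
  calc |u n| ≤ δ / (2 * L) * n + linearExcess (δ / (2 * L)) u := abs_le_add_linearExcess hu hε n
    _ < δ / (2 * L) * (L * c) + δ / 2 * c := by gcongr
    _ = δ * c := by field_simp; ring

variable {ι : Type*} {l : Filter ι} {c : ι → ℝ}

theorem tendsto_comp_div_of_isLittleO {u : ℕ → ℝ} (hu : u =o[atTop] fun n => (n : ℝ))
    {N : ι → ℕ} (hc : Tendsto c l atTop)
    (hN : l.IsBoundedUnder (· ≤ ·) fun t => (N t : ℝ) / c t) :
    Tendsto (fun t => u (N t) / c t) l (𝓝 0) := by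
  obtain ⟨b, hb⟩ := hN.eventually_le
  have hL : 0 < |b| + 1 := by positivity
  refine Metric.tendsto_nhds.2 fun δ hδ => ?_
  have hexc := (hc.const_mul_atTop (half_pos hδ)).eventually_gt_atTop
    (linearExcess (δ / (2 * (|b| + 1))) u)
  filter_upwards [hb, hc.eventually_gt_atTop 0, hexc] with t ht hct hexc
  have hNt : N t / c t < |b| + 1 := by linarith [le_abs_self b]
  rw [Real.dist_0_eq_abs, abs_div, abs_of_pos hct]
  exact abs_div_lt_of_linearExcess_lt hu hδ hL hct hNt hexc

theorem tendsto_measure_setOf_ge_atTop {Ω : Type*} [MeasurableSpace Ω] {P : Measure Ω}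
    [IsFiniteMeasure P] {Y : Ω → ℝ} (hY : AEMeasurable Y P) :
    Tendsto (fun L : ℝ => P {ω | L ≤ Y ω}) atTop (𝓝 0) := by
  have hanti : Antitone fun L : ℝ => {ω | L ≤ Y ω} := fun L L' hLL' ω hω => hLL'.trans hω
  have hempty : ⋂ L : ℝ, {ω | L ≤ Y ω} = ∅ := by
    ext ω
    simpa using exists_gt (Y ω)
  have h := tendsto_measure_iInter_atTop (μ := P)
    (fun L => nullMeasurableSet_le aemeasurable_const hY) hanti ⟨0, measure_ne_top _ _⟩
  rwa [hempty, measure_empty] at h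

theorem exists_eventually_measure_ge_le_of_tendstoInDistribution {Ω Ω' : Type*}
    [MeasurableSpace Ω] [MeasurableSpace Ω'] {P : Measure Ω} [IsProbabilityMeasure P]
    {P' : Measure Ω'} [IsProbabilityMeasure P'] {Y : ι → Ω → ℝ} {Z : Ω' → ℝ}
    (h : TendstoInDistribution Y l Z (fun _ => P) P') {η : ENNReal} (hη : 0 < η) :
    ∃ L : ℝ, 0 < L ∧ ∀ᶠ t in l, P {ω | L ≤ Y t ω} ≤ η := by
  obtain ⟨L, hLη, hL⟩ := (((tendsto_measure_setOf_ge_atTop h.aemeasurable_limit).eventually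
    (gt_mem_nhds hη)).and (eventually_gt_atTop 0)).exists
  refine ⟨L, hL, ?_⟩
  have hlimsup := ProbabilityMeasure.limsup_measure_closed_le_of_tendsto h.tendsto
    (isClosed_Ici (a := L))
  rw [ProbabilityMeasure.coe_mk, Measure.map_apply_of_aemeasurable h.aemeasurable_limit
    measurableSet_Ici] at hlimsup
  filter_upwards [eventually_lt_of_limsup_lt (hlimsup.trans_lt hLη)] with t ht
  rw [ProbabilityMeasure.coe_mk,
    Measure.map_apply_of_aemeasurable (h.forall_aemeasurable t) measurableSet_Ici] at ht
  exact ht.le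

theorem tendstoInMeasure_comp_div_of_ae_isLittleO {Ω : Type*} [MeasurableSpace Ω] {P : Measure Ω}
    [IsFiniteMeasure P] {K : ℕ → Ω → ℝ} (hK : ∀ n, Measurable (K n))
    (hKo : ∀ᵐ ω ∂P, (K · ω) =o[atTop] fun n => (n : ℝ)) {N : ι → Ω → ℕ} (hc : Tendsto c l atTop)
    (htight : ∀ η : ENNReal, 0 < η → ∃ L : ℝ, 0 < L ∧
      ∀ᶠ t in l, P {ω | L ≤ (N t ω : ℝ) / c t} ≤ η) :
    TendstoInMeasure P (fun t ω => K (N t ω) ω / c t) l fun _ => (0 : ℝ) := by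
  refine tendstoInMeasure_iff_norm.2 fun δ hδ => ENNReal.tendsto_nhds_zero.2 fun η hη => ?_
  obtain ⟨L, hL, hLt⟩ := htight (η / 2) (ENNReal.half_pos hη.ne')
  set C : Ω → ℝ := fun ω => linearExcess (δ / (2 * L)) (K · ω)
  have hC : Measurable C := (measurable_linearExcess _).comp (measurable_pi_lambda _ hK)
  have hCt : ∀ᶠ t in l, P {ω | δ / 2 * c t ≤ C ω} ≤ η / 2 :=
    ENNReal.tendsto_nhds_zero.1 ((tendsto_measure_setOf_ge_atTop hC.aemeasurable).comp
      (hc.const_mul_atTop (half_pos hδ))) _ (ENNReal.half_pos hη.ne')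
  filter_upwards [hLt, hCt, hc.eventually_gt_atTop 0] with t hLt hCt hct
  have hsub : ∀ᵐ ω ∂P, δ ≤ ‖K (N t ω) ω / c t - 0‖ → L ≤ N t ω / c t ∨ δ / 2 * c t ≤ C ω := by
    filter_upwards [hKo] with ω hω hδω
    by_contra! hnot
    rw [sub_zero, Real.norm_eq_abs, abs_div, abs_of_pos hct] at hδω
    exact hδω.not_gt (abs_div_lt_of_linearExcess_lt hω hδ hL hct hnot.1 hnot.2)
  calc P {ω | δ ≤ ‖K (N t ω) ω / c t - 0‖}
      ≤ P ({ω | L ≤ (N t ω : ℝ) / c t} ∪ {ω | δ / 2 * c t ≤ C ω}) := measure_mono_ae hsub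
    _ ≤ η / 2 + η / 2 := (measure_union_le _ _).trans (add_le_add hLt hCt)
    _ = η := ENNReal.add_halves η

end RandomIndex

end NearMax

theorem corollary4p1_general {Ω Ω' ι : Type*} [MeasurableSpace Ω] [MeasurableSpace Ω']
    (P : Measure Ω) [IsProbabilityMeasure P] (P' : Measure Ω') [IsProbabilityMeasure P']
    (X : ℕ → Ω → ℝ) (hX : ∀ n, Measurable (X n)) (hstat : NearMax.StrictlyStationary P X)
    (γ : Ω → EReal)
    (hγ : NearMax.IsCondRightEndpoint P (X 0) (NearMax.invariantSigma X) γ)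
    (hγtop : ∀ᵐ ω ∂P, γ ω = ⊤)
    (k : ℕ → ℕ) (hk : ∀ᶠ n in atTop, k n ≤ n)
    (hklim : Tendsto (fun n : ℕ => (k n : ℝ) / (n : ℝ)) atTop (𝓝 1))
    (a : ℝ) {l : Filter ι} (N : ι → Ω → ℕ) (c : ι → ℝ) (hc : Tendsto c l atTop) :
    (∀ Z : Ω → ℝ, (∀ᵐ ω ∂P, Tendsto (fun t => (N t ω : ℝ) / c t) l (𝓝 (Z ω))) →
      ∀ᵐ ω ∂P, Tendsto (fun t =>
        NearMax.nearCount (fun i => X i ω) (k (N t ω)) (N t ω) a / c t) l (𝓝 0)) ∧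
    (∀ Z : Ω' → ℝ,
      TendstoInDistribution (fun t ω => (N t ω : ℝ) / c t) l Z (fun _ => P) P' →
      TendstoInMeasure P (fun t ω =>
        NearMax.nearCount (fun i => X i ω) (k (N t ω)) (N t ω) a / c t) l
        (fun _ => (0 : ℝ))) := by
  have hlaw := NearMax.ae_isLittleO_nearCount hX hstat hγ hγtop hk hklim a
  refine ⟨fun Z hZ => ?_, fun Z hZ => ?_⟩
  · filter_upwards [hlaw, hZ] with ω hω hZω
    exact NearMax.tendsto_comp_div_of_isLittleO hω hc hZω.isBoundedUnder_le
  · refine NearMax.tendstoInMeasure_comp_div_of_ae_isLittleO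
      (K := fun n ω => NearMax.nearCount (fun i => X i ω) (k n) n a) (fun n => ?_) hlaw hc
      fun η hη => NearMax.exists_eventually_measure_ge_le_of_tendstoInDistribution hZ hη
    exact (NearMax.measurable_nearCount (k n) n a).comp (measurable_pi_lambda _ hX)

theorem corollary4p1 {Ω Ω' : Type*} [MeasurableSpace Ω] [MeasurableSpace Ω']
    (P : Measure Ω) [IsProbabilityMeasure P] (P' : Measure Ω') [IsProbabilityMeasure P']
    (X : ℕ → Ω → ℝ) (hX : ∀ n, Measurable (X n)) (hstat : NearMax.StrictlyStationary P X)
    (γ : Ω → EReal)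
    (hγ : NearMax.IsCondRightEndpoint P (X 0) (NearMax.invariantSigma X) γ)
    (hγtop : ∀ᵐ ω ∂P, γ ω = ⊤)
    (k : ℕ → ℕ) (hk : ∀ n, 1 ≤ n → 1 ≤ k n ∧ k n ≤ n)
    (hklim : Tendsto (fun n : ℕ => (k n : ℝ) / (n : ℝ)) atTop (𝓝 1))
    (a : ℝ) (ha : 0 < a)
    (N : ℝ≥0 → Ω → ℕ) (hN : ∀ t, Measurable (N t))
    (c : ℝ≥0 → ℝ) (hcpos : ∀ t, 0 < c t) (hc : Tendsto c atTop atTop) :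
    (∀ Z : Ω → ℝ, Measurable Z → (∀ᵐ ω ∂P, 0 < Z ω) →
      (∀ᵐ ω ∂P, Tendsto (fun t => (N t ω : ℝ) / c t) atTop (𝓝 (Z ω))) →
      ∀ᵐ ω ∂P, Tendsto (fun t => NearMax.nearClaimCount X N k a t ω / c t) atTop (𝓝 0)) ∧
    (∀ Z : Ω' → ℝ, Measurable Z → (∀ᵐ ω ∂P', 0 < Z ω) →
      TendstoInDistribution (fun t ω => (N t ω : ℝ) / c t) atTop Z (fun _ => P) P' →
      TendstoInMeasure P (fun t ω => NearMax.nearClaimCount X N k a t ω / c t) atTop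
        (fun _ => (0 : ℝ))) := by
  have h := corollary4p1_general P P' X hX hstat γ hγ hγtop k
    (eventually_atTop.2 ⟨1, fun n hn => (hk n hn).2⟩) hklim a N c hc
  exact ⟨fun Z _ _ => h.1 Z, fun Z _ _ => h.2 Z⟩
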